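/- Let $p\ge 1$ and let $\boldsymbol{\mathcal B}=(\beta_n)_{n\ge 1}$ be an alternate base with period $p$, i.e. a sequence of real numbers $\beta_n>1$ with $\beta_{n+p}=\beta_n$ for all $n\ge1$. For $k\ge1$ let $\boldsymbol{\mathcal B}^{(k)}=(\beta_n)_{n\ge k}$; then $\boldsymbol{\mathcal B}^{(k)}=\boldsymbol{\mathcal B}^{(k+p)}$, so $k$ is counted modulo $p$. For $x\in[0,1]$, the $\boldsymbol{\mathcal B}$-expansion $d_{\boldsymbol{\mathcal B}}(x)=x_1x_2x_3\cdots$ is the sequence of non-negative integers given by the greedy algorithm $r_0=x$, $x_n=\lfloor\beta_n r_{n-1}\rfloor$, $r_n=\beta_n r_{n-1}-x_n$ ($n\ge1$). Let $\mathrm{Fin}(\boldsymbol{\mathcal B})$ be the set of $x\in[0,1)$ such that $d_{\boldsymbol{\mathcal B}}(x)$ has only finitely many non-zero digits. Write $\mathbf t^{(\ell)}=t^{(\ell)}_1t^{(\ell)}_2t^{(\ell)}_3\cdots=d_{\boldsymbol{\mathcal B}^{(\ell)}}(1)$, where the upper index $\ell$ is counted modulo $p$. Suppose that $$t_1^{(\ell)}\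 \ge\ t_2^{(\ell-1)}\ \ge\ t_3^{(\ell-2)}\ \ge\ \cdots\qquad\text{for every }\ell\in\mathbb Z_p .$$ Then $\boldsymbol{\mathcal B}$ is a Parry alternate base, i.e. every $\mathbf t^{(\ell)}$, $\ell\in\mathbb Z_p$, is eventually periodic, and $\boldsymbol{\mathcal B}$ has the positive finiteness property (PF): for all $x,y\in\mathrm{Fin}(\boldsymbol{\mathcal B})$, if $x+y\in[0,1)$ then $x+y\in\mathrm{Fin}(\boldsymbol{\mathcal B})$. If moreover $\boldsymbol{\mathcal B}$ is a simple Parry alternate base, i.e. every $\mathbf t^{(\ell)}$ has only finitely many non-zero digits, then $\boldsymbol{\mathcal B}$ has the finiteness property (F): for all $x,y\in\mathrm{Fin}(\boldsymbol{\mathcal B})$, if $x+y\in[0,1)$ then $x+y\in\mathrm{Fin}(\boldsymbol{\mathcal B})$, and if $x-y\in[0,1)$ then $x-y\in\mathrm{Fin}(\boldsymbol{\mathcal B})$. -/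

import Mathlib

noncomputable section

namespace CantorBase

/- Bases and digit strings are indexed from zero: `β n` is the base element `β_{n+1}`,
and `x n` is the digit `x_{n+1}`. -/

/-- A Cantor real base: real numbers `β_n > 1` whose product diverges to `+∞`. -/
def IsCantorBase (β : ℕ → ℝ) : Prop :=
  (∀ n, 1 < β n) ∧
    Filter.Tendsto (fun n => ∏ i ∈ Finset.range n, β i) Filter.atTop Filter.atTop

/-- The remainders of the greedy algorithm: `r_0 = x`, `r_{n+1} = β_{n+1} r_n - ⌊β_{n+1} r_n⌋`. -/
def remainder (β : ℕ → ℝ) (x : ℝ) : ℕ → ℝ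
  | 0 => x
  | n + 1 => β n * remainder β x n - (⌊β n * remainder β x n⌋₊ : ℝ)

/-- The `β`-expansion `d_β(x)` of `x ∈ [0,1]`, given by the greedy algorithm:
`x_{n+1} = ⌊β_{n+1} r_n⌋`. -/
def expansion (β : ℕ → ℝ) (x : ℝ) (n : ℕ) : ℕ :=
  ⌊β n * remainder β x n⌋₊

/-- The digit string has finite support, i.e. it belongs to `𝓕`. -/
def FiniteSupport (a : ℕ → ℕ) : Prop :=
  {n | a n ≠ 0}.Finite

/-- `Fin(β)`: the numbers in `[0,1)` whose `β`-expansion is finite. -/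
def FinSet (β : ℕ → ℝ) : Set ℝ :=
  {x | x ∈ Set.Ico (0 : ℝ) 1 ∧ FiniteSupport (expansion β x)}

/-- Property (PF), the positive finiteness property. -/
def PropertyPF (β : ℕ → ℝ) : Prop :=
  ∀ x ∈ FinSet β, ∀ y ∈ FinSet β, x + y ∈ Set.Ico (0 : ℝ) 1 → x + y ∈ FinSet β

/-- Property (F), the finiteness property. -/
def PropertyF (β : ℕ → ℝ) : Prop :=
  ∀ x ∈ FinSet β, ∀ y ∈ FinSet β,
    (x + y ∈ Set.Ico (0 : ℝ) 1 → x + y ∈ FinSet β) ∧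
    (x - y ∈ Set.Ico (0 : ℝ) 1 → x - y ∈ FinSet β)

/-- The base obtained by dropping the first `k` elements. -/
def shift (β : ℕ → ℝ) (k : ℕ) : ℕ → ℝ :=
  fun n => β (n + k)

/-- An alternate base with period `p ≥ 1`: a Cantor real base which is purely periodic
with period `p`. -/
def IsAlternateBase (p : ℕ) (β : ℕ → ℝ) : Prop :=
  IsCantorBase β ∧ 0 < p ∧ Function.Periodic β p

/-- For an alternate base of period `p`, the expansion of `1` in the shifted base that starts at
the (zero-based) index `ℓ`, where `ℓ` is counted modulo `p`. In one-based notation this is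
`𝐭^(ℓ+1) = d_{β^(ℓ+1)}(1)`. -/
def expansionOfOne (p : ℕ) (β : ℕ → ℝ) (ℓ : ZMod p) : ℕ → ℕ :=
  expansion (shift β ℓ.val) 1

/-- A sequence of digits is eventually periodic. -/
def EventuallyPeriodic (a : ℕ → ℕ) : Prop :=
  ∃ N q : ℕ, 0 < q ∧ ∀ n, N ≤ n → a (n + q) = a n

/-- An alternate base is Parry if all expansions of `1` are eventually periodic. -/
def IsParry (p : ℕ) (β : ℕ → ℝ) : Prop :=
  IsAlternateBase p β ∧ ∀ ℓ : ZMod p, EventuallyPeriodic (expansionOfOne p β ℓ)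

/-- A Parry alternate base is simple if all expansions of `1` are finite. -/
def IsSimpleParry (p : ℕ) (β : ℕ → ℝ) : Prop :=
  IsParry p β ∧ ∀ ℓ : ZMod p, FiniteSupport (expansionOfOne p β ℓ)

end CantorBase

end

/-!
The argument rests on carries. A unit at position `n - 1` has the same value as the expansion of
one, `t^(n)`, written from position `n` on; `carry β n` is the digitwise effect of replacing the
latter by the former. A finite string of value less than one that is not greedy, read from a
suitable position `n ≥ 1` on, either is the whole expansion of one or begins with `t_1 ⋯ t_k`
followed by a digit larger than `t_{k+1}`. In the first case one adds `carry β n`.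
In the second case one adds `carry β n` and subtracts the carry into the position of that larger
digit. The tail of `t^(n)` is then subtracted from another expansion of one which, by the
hypothesis, dominates it digit by digit. So the digits stay non-negative; the value is unchanged
and the string becomes lexicographically greater (`IsCarryWeight.exists_lex_greater`). Moreover
only finitely many digits change, because the descending chains of the hypothesis are eventually
constant. This stabilisation also gives the eventual periodicity of the expansions of one.

It remains to see that such rewriting reaches a greedy string. Give the positions positive weights,
depending on the position modulo the period, such that no rewriting step increases the total
weight. They exist because the condition on them is governed by a non-negative matrix whose column
sums telescope along the chains, and which is irreducible thanks to the units carried to the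
preceding position (`exists_pos_weight`, `exists_weight`). Strings of bounded weight and given value
form a compact set of finite strings, so there is a lexicographically greatest one
(`exists_lex_max`); it admits no rewriting step, hence is greedy
(`IsCarryWeight.finiteSupport_expansion`). Thus `FinSet β` consists of the numbers in `[0, 1)` that
are values of finite strings with arbitrary non-negative digits, and this set is visibly closed
under addition.

For subtraction, if the expansions of one are finite, a unit at one position can be unfolded into
a unit at any later position plus further non-negative digits
(`scale_sub_scale_mem_finiteValues`), so the units of `y` can be subtracted from `x` one at a time.
-/

namespace CantorBase

/-! ### Greedy expansions and their values -/

/-- The reciprocal `1 / (β_0 ⋯ β_{n-1})`. The digit at (zero-based) position `i` contributes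
with the factor `scale β (i + 1)`. -/
noncomputable def scale (β : ℕ → ℝ) (n : ℕ) : ℝ := (∏ i ∈ Finset.range n, β i)⁻¹

section Greedy

variable {β : ℕ → ℝ} {x : ℝ}

lemma scale_zero : scale β 0 = 1 := by simp [scale]

lemma scale_pos (hβ : ∀ n, 1 < β n) (n : ℕ) : 0 < scale β n :=
  inv_pos.2 (Finset.prod_pos fun i _ => zero_lt_one.trans (hβ i))

lemma mul_scale_succ (hβ : ∀ n, 1 < β n) (n : ℕ) : β n * scale β (n + 1) = scale β n := by
  have h : β n ≠ 0 := (zero_lt_one.trans (hβ n)).ne'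
  rw [scale, scale, Finset.prod_range_succ, mul_inv, mul_comm, mul_assoc, inv_mul_cancel₀ h,
    mul_one]

lemma tendsto_scale (hβ : IsCantorBase β) :
    Filter.Tendsto (scale β) Filter.atTop (nhds 0) :=
  tendsto_inv_atTop_zero.comp hβ.2

lemma shift_zero : shift β 0 = β := rfl

lemma one_lt_shift (hβ : ∀ n, 1 < β n) (k n : ℕ) : 1 < shift β k n := hβ _

lemma mul_remainder (n : ℕ) :
    β n * remainder β x n = expansion β x n + remainder β x (n + 1) := by
  simp [remainder, expansion]

lemma remainder_nonneg (hβ : ∀ n, 1 < β n) (hx : 0 ≤ x) (n : ℕ) : 0 ≤ remainder β x n := by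
  induction n with
  | zero => exact hx
  | succ n ih =>
    exact sub_nonneg.2 (Nat.floor_le (mul_nonneg (zero_lt_one.trans (hβ n)).le ih))

lemma remainder_succ_lt_one (n : ℕ) : remainder β x (n + 1) < 1 :=
  sub_lt_iff_lt_add'.2 (by simpa using Nat.lt_floor_add_one (β n * remainder β x n))

lemma sum_expansion (hβ : ∀ n, 1 < β n) (x : ℝ) (n N : ℕ) :
    ∑ j ∈ Finset.range N, (expansion (shift β n) x j : ℝ) * scale β (n + j + 1) =
      x * scale β n - remainder (shift β n) x N * scale β (n + N) := by
  induction N with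
  | zero => simp [remainder]
  | succ N ih =>
    have h1 := mul_remainder (β := shift β n) (x := x) N
    have h2 := mul_scale_succ hβ (n + N)
    have h3 : shift β n N = β (n + N) := by rw [shift, add_comm]
    rw [h3] at h1
    rw [Finset.sum_range_succ, ih, ← h2, ← add_assoc n N 1]
    linear_combination -scale β (n + N + 1) * h1

/-- The greedy expansion represents `x`, here in the base starting at index `n`, with values
measured in the original base. -/
lemma hasSum_expansion (hβ : IsCantorBase β) (hx : 0 ≤ x) (n : ℕ) :
    HasSum (fun j => (expansion (shift β n) x j : ℝ) * scale β (n + j + 1)) (x * scale β n) := by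
  rw [hasSum_iff_tendsto_nat_of_nonneg
    (fun j => mul_nonneg (Nat.cast_nonneg _) (scale_pos hβ.1 _).le)]
  simp_rw [sum_expansion hβ.1]
  have h0 : Filter.Tendsto (fun N => scale β (n + N)) Filter.atTop (nhds 0) :=
    (tendsto_scale hβ).comp (Filter.tendsto_add_atTop_nat n |>.congr fun a => add_comm a n)
  have h1 : Filter.Tendsto (fun N => remainder (shift β n) x N * scale β (n + N))
      Filter.atTop (nhds 0) := by
    refine squeeze_zero' (.of_forall fun N => mul_nonneg
      (remainder_nonneg (one_lt_shift hβ.1 n) hx N) (scale_pos hβ.1 _).le) ?_ h0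
    filter_upwards [Filter.eventually_ge_atTop 1] with N hN
    obtain ⟨M, rfl⟩ := Nat.exists_eq_add_of_le' hN
    exact mul_le_of_le_one_left (scale_pos hβ.1 _).le (remainder_succ_lt_one M).le
  simpa using h1.const_sub (x * scale β n)

lemma IsAlternateBase.exists_one_lt_le {p : ℕ} (hβ : IsAlternateBase p β) :
    ∃ δ : ℝ, 1 < δ ∧ ∀ n, δ ≤ β n := by
  obtain ⟨m, -, hm⟩ := Finset.exists_min_image (Finset.range p) β ⟨0, by simpa using hβ.2.1⟩
  refine ⟨β m, hβ.1.1 m, fun n => ?_⟩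
  rw [← hβ.2.2.map_mod_nat n]
  exact hm _ (Finset.mem_range.2 (Nat.mod_lt _ hβ.2.1))

lemma IsAlternateBase.summable_scale {p : ℕ} (hβ : IsAlternateBase p β) :
    Summable (scale β) := by
  obtain ⟨δ, h1, hδ⟩ := hβ.exists_one_lt_le
  have h0 : 0 < δ := zero_lt_one.trans h1
  refine Summable.of_nonneg_of_le (fun n => (scale_pos hβ.1.1 n).le) (fun n => ?_)
    (summable_geometric_of_lt_one (inv_nonneg.2 h0.le) (inv_lt_one_of_one_lt₀ h1))
  rw [scale, inv_pow]
  refine inv_anti₀ (pow_pos h0 n) ?_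
  calc δ ^ n = ∏ _i ∈ Finset.range n, δ := by simp
    _ ≤ _ := Finset.prod_le_prod (fun _ _ => h0.le) fun i _ => hδ i

end Greedy

/-! ### Lexicographically greatest representations of bounded weight -/

/-- The digit strings of value `v`, where position `i` has the value `c i`, and of weight at most
`M`, where position `i` has the weight `w i`. The weight is bounded through its partial sums, so
that the set is visibly closed. -/
def boundedRep (c w : ℕ → ℝ) (M v : ℝ) : Set (ℕ → ℕ) :=
  {b | (∀ N, ∑ i ∈ Finset.range N, (b i : ℝ) * w i ≤ M) ∧ ∑' i, (b i : ℝ) * c i = v}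

section LexMax

variable {c w : ℕ → ℝ} {M v ε : ℝ}

lemma sum_digits_le (hε : 0 < ε) (hw : ∀ i, ε ≤ w i) {b : ℕ → ℕ}
    (hb : ∀ N, ∑ i ∈ Finset.range N, (b i : ℝ) * w i ≤ M) (N : ℕ) :
    ∑ i ∈ Finset.range N, (b i : ℝ) ≤ M / ε := by
  rw [le_div_iff₀ hε, Finset.sum_mul]
  exact (Finset.sum_le_sum fun i _ =>
    mul_le_mul_of_nonneg_left (hw i) (Nat.cast_nonneg _)).trans (hb N)

lemma digit_le (hε : 0 < ε) (hw : ∀ i, ε ≤ w i) {b : ℕ → ℕ}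
    (hb : ∀ N, ∑ i ∈ Finset.range N, (b i : ℝ) * w i ≤ M) (i : ℕ) : (b i : ℝ) ≤ M / ε :=
  (Finset.single_le_sum (f := fun i => (b i : ℝ)) (fun _ _ => Nat.cast_nonneg _)
    (Finset.self_mem_range_succ i)).trans (sum_digits_le hε hw hb (i + 1))

/-- Strings of bounded weight are finite, because each non-zero digit costs at least `ε`. -/
lemma finiteSupport_of_sum_le (hε : 0 < ε) (hw : ∀ i, ε ≤ w i) {b : ℕ → ℕ}
    (hb : ∀ N, ∑ i ∈ Finset.range N, (b i : ℝ) * w i ≤ M) : FiniteSupport b := by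
  have hs : Summable fun i => (b i : ℝ) :=
    summable_of_sum_range_le (fun _ => Nat.cast_nonneg _) (sum_digits_le hε hw hb)
  have h := hs.tendsto_cofinite_zero.eventually (gt_mem_nhds one_pos)
  refine (Filter.eventually_cofinite.1 h).subset fun i hi => ?_
  simpa using hi

lemma continuousOn_tsum_digits {C : ℝ} {c : ℕ → ℝ} (hc : Summable c) (hc0 : ∀ i, 0 ≤ c i) :
    ContinuousOn (fun b : ℕ → ℕ => ∑' i, (b i : ℝ) * c i) {b | ∀ i, (b i : ℝ) ≤ C} := by
  refine continuousOn_tsum (u := fun i => C * c i) (fun i => ?_) (hc.mul_left C) fun i b hb => ?_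
  · exact ((continuous_of_discreteTopology (f := fun k : ℕ => (k : ℝ))).comp
      (continuous_apply i)).continuousOn.mul continuousOn_const
  · rw [Real.norm_of_nonneg (mul_nonneg (Nat.cast_nonneg _) (hc0 i))]
    exact mul_le_mul_of_nonneg_right (hb i) (hc0 i)

lemma isCompact_digits_le (C : ℝ) : IsCompact {b : ℕ → ℕ | ∀ i, (b i : ℝ) ≤ C} := by
  have h : {b : ℕ → ℕ | ∀ i, (b i : ℝ) ≤ C} = Set.univ.pi fun _ => {k : ℕ | (k : ℝ) ≤ C} := by
    ext b; simp
  rw [h]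
  refine isCompact_univ_pi fun _ => Set.Finite.isCompact ?_
  refine (Set.finite_Iic ⌊C⌋₊).subset fun k hk => ?_
  exact Nat.le_floor hk

lemma isCompact_boundedRep (hc : Summable c) (hc0 : ∀ i, 0 ≤ c i) (hε : 0 < ε)
    (hw : ∀ i, ε ≤ w i) : IsCompact (boundedRep c w M v) := by
  have hK := isCompact_digits_le (M / ε)
  have h1 := (continuousOn_tsum_digits (C := M / ε) hc hc0).preimage_isClosed_of_isClosed
    hK.isClosed (isClosed_singleton (x := v))
  have h2 : IsClosed {b : ℕ → ℕ | ∀ N, ∑ i ∈ Finset.range N, (b i : ℝ) * w i ≤ M} := by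
    rw [Set.ofPred_forall]
    refine isClosed_iInter fun N => isClosed_le (continuous_finsetSum _ fun i _ => ?_)
      continuous_const
    exact ((continuous_of_discreteTopology (f := fun k : ℕ => (k : ℝ))).comp
      (continuous_apply i)).mul continuous_const
  have h : boundedRep c w M v = ({b | ∀ i, (b i : ℝ) ≤ M / ε} ∩
      (fun b : ℕ → ℕ => ∑' i, (b i : ℝ) * c i) ⁻¹' {v}) ∩
      {b | ∀ N, ∑ i ∈ Finset.range N, (b i : ℝ) * w i ≤ M} := by
    ext b
    exact ⟨fun hb => ⟨⟨digit_le hε hw hb.1, hb.2⟩, hb.1⟩, fun hb => ⟨hb.2, hb.1.2⟩⟩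
  rw [h]
  exact hK.of_isClosed_subset (h1.inter h2) fun b hb => hb.1.1

/-- A non-empty set of strings of given value and bounded weight has a lexicographically greatest
element. It is found by maximising `∑ b_i θ^i` on the compact set `boundedRep c w M v`, with `θ` so
small that the digits from any position on cannot outweigh one unit at the preceding position. -/
lemma exists_lex_max (hc : Summable c) (hc0 : ∀ i, 0 ≤ c i) (hε : 0 < ε)
    (hw : ∀ i, ε ≤ w i) (hne : (boundedRep c w M v).Nonempty) :
    ∃ b ∈ boundedRep c w M v, ∀ b' ∈ boundedRep c w M v, ∀ m,
      (∀ i < m, b' i = b i) → b' m ≤ b m := by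
  obtain ⟨b₀, hb₀⟩ := hne
  have hC : 0 ≤ M / ε := (Nat.cast_nonneg _).trans (digit_le hε hw hb₀.1 0)
  set C := M / ε with hCdef
  set θ : ℝ := 1 / (C + 2) with hθdef
  have hθ0 : 0 < θ := by positivity
  have hθ1 : θ < 1 := by rw [hθdef, div_lt_one (by positivity)]; linarith
  have hθC : C * θ < 1 := by
    rw [hθdef, mul_one_div, div_lt_one (by positivity)]; linarith
  have hθs : Summable fun i : ℕ => θ ^ i := summable_geometric_of_lt_one hθ0.le hθ1
  have hcont : ContinuousOn (fun b : ℕ → ℕ => ∑' i, (b i : ℝ) * θ ^ i) (boundedRep c w M v) :=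
    (continuousOn_tsum_digits (C := C) hθs fun i => (pow_pos hθ0 i).le).mono
      fun b hb => digit_le hε hw hb.1
  obtain ⟨b, hb, hmax⟩ := (isCompact_boundedRep hc hc0 hε hw).exists_isMaxOn ⟨b₀, hb₀⟩ hcont
  refine ⟨b, hb, fun b' hb' m hm => ?_⟩
  by_contra! hlt
  have hnn : ∀ (a : ℕ → ℕ) (i : ℕ), 0 ≤ (a i : ℝ) * θ ^ i := fun a i => by positivity
  have hs : Summable fun i => (b' i : ℝ) * θ ^ i :=
    Summable.of_nonneg_of_le (hnn b')
      (fun i => mul_le_mul_of_nonneg_right (digit_le hε hw hb'.1 i) (pow_pos hθ0 i).le)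
      (hθs.mul_left C)
  have h1 : ∑ i ∈ Finset.range (m + 1), (b' i : ℝ) * θ ^ i ≤ ∑' i, (b' i : ℝ) * θ ^ i :=
    hs.sum_le_tsum _ fun i _ => hnn b' i
  have h2 : ∑' i, (b i : ℝ) * θ ^ i ≤
      ∑ i ∈ Finset.range (m + 1), (b i : ℝ) * θ ^ i + C * θ ^ (m + 1) := by
    refine Real.tsum_le_of_sum_range_le (hnn b) fun N => ?_
    have hsplit : ∑ i ∈ Finset.range N, (b i : ℝ) * θ ^ i ≤
        ∑ i ∈ Finset.range (m + 1 + N), (b i : ℝ) * θ ^ i :=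
      Finset.sum_le_sum_of_subset_of_nonneg (Finset.range_mono (by lia)) fun i _ _ => hnn b i
    rw [Finset.sum_range_add] at hsplit
    refine hsplit.trans (add_le_add_right ?_ _)
    have h3 : ∑ j ∈ Finset.range N, (b (m + 1 + j) : ℝ) ≤ C := by
      have h4 := sum_digits_le hε hw hb.1 (m + 1 + N)
      rw [Finset.sum_range_add] at h4
      exact le_trans (le_add_of_nonneg_left (by positivity)) h4
    refine le_trans ?_ (mul_le_mul_of_nonneg_right h3 (pow_pos hθ0 (m + 1)).le)
    rw [Finset.sum_mul]
    exact Finset.sum_le_sum fun j _ => mul_le_mul_of_nonneg_left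
      (pow_le_pow_of_le_one hθ0.le hθ1.le (by lia)) (Nat.cast_nonneg _)
  have h3 : ∑' i, (b' i : ℝ) * θ ^ i ≤ ∑' i, (b i : ℝ) * θ ^ i := hmax hb'
  rw [Finset.sum_range_succ] at h1 h2
  rw [Finset.sum_congr rfl fun i hi => by rw [hm i (Finset.mem_range.1 hi)]] at h1
  have h4 : ((b m : ℝ) + 1) * θ ^ m ≤ b' m * θ ^ m :=
    mul_le_mul_of_nonneg_right (by exact_mod_cast hlt) (pow_pos hθ0 m).le
  have h5 : C * θ ^ (m + 1) < θ ^ m := by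
    rw [pow_succ, mul_comm (θ ^ m), ← mul_assoc]
    exact mul_lt_of_lt_one_left (pow_pos hθ0 m) hθC
  linarith

end LexMax

/-! ### Positive weights -/

/-- A non-negative matrix that is irreducible along the cycle `m ↦ m + 1` has a positive vector
in the kernel of `diagonal (column sums) - A`: this matrix is singular, the absolute value of a
kernel vector is again in the kernel because the column sums balance, and positivity spreads along
the cycle. -/
lemma exists_pos_weight {p : ℕ} [NeZero p] (A : Matrix (ZMod p) (ZMod p) ℝ)
    (hA : ∀ n m, 0 ≤ A n m) (hcyc : ∀ m, 0 < A (m + 1) m) :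
    ∃ w : ZMod p → ℝ, (∀ m, 0 < w m) ∧ ∀ n, (∑ k, A k n) * w n = ∑ m, A n m * w m := by
  set s : ZMod p → ℝ := fun n => ∑ k, A k n with hs
  have hdet : (Matrix.diagonal s - A).det = 0 := by
    refine Matrix.exists_vecMul_eq_zero_iff.1 ⟨1, one_ne_zero, ?_⟩
    ext m
    simp [Matrix.vecMul, dotProduct, Matrix.diagonal_apply, hs]
  obtain ⟨v, hv0, hv⟩ := Matrix.exists_mulVec_eq_zero_iff.2 hdet
  have hv' : ∀ n, s n * v n = ∑ m, A n m * v m := fun n => by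
    have h := congrFun hv n
    rw [Matrix.sub_mulVec, Pi.sub_apply, Matrix.mulVec_diagonal, Pi.zero_apply, sub_eq_zero] at h
    exact h
  have hs0 : ∀ n, 0 ≤ s n := fun n => Finset.sum_nonneg fun k _ => hA k n
  have hle : ∀ n ∈ Finset.univ, s n * |v n| ≤ ∑ m, A n m * |v m| := fun n _ => by
    calc s n * |v n| = |s n * v n| := by rw [abs_mul, abs_of_nonneg (hs0 n)]
      _ = |∑ m, A n m * v m| := by rw [hv']
      _ ≤ ∑ m, |A n m * v m| := Finset.abs_sum_le_sum_abs _ _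
      _ = ∑ m, A n m * |v m| := by simp [abs_mul, abs_of_nonneg (hA _ _)]
  have hsum : ∑ n, s n * |v n| = ∑ n, ∑ m, A n m * |v m| := by
    rw [Finset.sum_comm]
    simp [hs, Finset.sum_mul]
  have heq := (Finset.sum_eq_sum_iff_of_le hle).1 hsum
  refine ⟨fun n => |v n|, ?_, fun n => heq n (Finset.mem_univ n)⟩
  have hstep : ∀ m, 0 < |v m| → 0 < |v (m + 1)| := fun m hm => by
    by_contra! h0
    have h1 : |v (m + 1)| = 0 := le_antisymm h0 (abs_nonneg _)
    have h2 := heq (m + 1) (Finset.mem_univ _)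
    rw [h1, mul_zero] at h2
    have h3 := Finset.single_le_sum (f := fun k => A (m + 1) k * |v k|)
      (fun k _ => mul_nonneg (hA _ _) (abs_nonneg _)) (Finset.mem_univ m)
    have h4 := mul_pos (hcyc m) hm
    linarith
  obtain ⟨a, ha⟩ := Function.ne_iff.1 hv0
  have hall : ∀ k : ℕ, 0 < |v (a + k)| := fun k => by
    induction k with
    | zero => simpa using ha
    | succ k ih => simpa [add_assoc] using hstep _ ih
  intro m
  have := hall (m - a).val
  simpa using this

/-! ### The expansions of one -/

/-- The greedy expansion of `1` in the base starting at index `n`, with `n` a natural number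
instead of a residue. -/
noncomputable def oneDigits (β : ℕ → ℝ) (n : ℕ) : ℕ → ℕ := expansion (shift β n) 1

section One

variable {β : ℕ → ℝ} {p : ℕ}

lemma IsAlternateBase.expansionOfOne_natCast (hβ : IsAlternateBase p β) (n : ℕ) :
    expansionOfOne p β (n : ZMod p) = oneDigits β n := by
  rw [expansionOfOne, oneDigits, ZMod.val_natCast]
  congr 1
  ext k
  rw [shift, shift, ← hβ.2.2.map_mod_nat (k + n % p), ← hβ.2.2.map_mod_nat (k + n),
    Nat.add_mod_mod]

lemma one_le_oneDigits_zero (hβ : ∀ n, 1 < β n) (n : ℕ) : 1 ≤ oneDigits β n 0 := by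
  rw [oneDigits, expansion, Nat.one_le_floor_iff, remainder, mul_one]
  exact (one_lt_shift hβ n 0).le

/-- Along each descending chain of the hypothesis the digits stabilise; since there are finitely
many chains, they do so from a common index on. -/
lemma exists_stable [NeZero p] (h : ∀ ℓ : ZMod p, Antitone fun n : ℕ =>
    expansionOfOne p β (ℓ - (n : ZMod p)) n) :
    ∃ K, ∀ (ℓ : ZMod p) (j : ℕ), K ≤ j →
      expansionOfOne p β ℓ (j + 1) = expansionOfOne p β (ℓ + 1) j := by
  have hst : ∀ ℓ : ZMod p, ∃ k : ℕ, ∀ m : ℕ, k ≤ m →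
      expansionOfOne p β (ℓ - (k : ZMod p)) k = expansionOfOne p β (ℓ - (m : ZMod p)) m :=
    fun ℓ => WellFoundedGT.monotone_chain_condition (α := ℕᵒᵈ) ⟨_, (h ℓ).dual_right⟩
  choose k hk using hst
  refine ⟨Finset.univ.sup k, fun ℓ j hj => ?_⟩
  have hj' : k (ℓ + 1 + j) ≤ j := (Finset.le_sup (Finset.mem_univ _)).trans hj
  have h1 := (hk (ℓ + 1 + j) j hj').symm.trans (hk (ℓ + 1 + j) (j + 1) (hj'.trans j.le_succ))
  have e1 : ℓ + 1 + (j : ZMod p) - j = ℓ + 1 := by ring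
  have e2 : ℓ + 1 + (j : ZMod p) - ((j + 1 : ℕ) : ZMod p) = ℓ := by push_cast; ring
  rw [e1, e2] at h1
  exact h1.symm

lemma expansionOfOne_succ_le (h : ∀ ℓ : ZMod p, Antitone fun n : ℕ =>
    expansionOfOne p β (ℓ - (n : ZMod p)) n) (ℓ : ZMod p) (j : ℕ) :
    expansionOfOne p β ℓ (j + 1) ≤ expansionOfOne p β (ℓ + 1) j := by
  have h1 := h (ℓ + 1 + j) (Nat.le_add_right j 1)
  have e1 : ℓ + 1 + (j : ZMod p) - j = ℓ + 1 := by ring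
  have e2 : ℓ + 1 + (j : ZMod p) - ((j + 1 : ℕ) : ZMod p) = ℓ := by push_cast; ring
  simp only [e1, e2] at h1
  exact h1

lemma eventuallyPeriodic_of_stable [NeZero p] {K : ℕ} (hK : ∀ (ℓ : ZMod p) (j : ℕ), K ≤ j →
      expansionOfOne p β ℓ (j + 1) = expansionOfOne p β (ℓ + 1) j) (ℓ : ZMod p) :
    EventuallyPeriodic (expansionOfOne p β ℓ) := by
  refine ⟨K, p, NeZero.pos p, fun j hj => ?_⟩
  have hq : ∀ q : ℕ, expansionOfOne p β ℓ (j + q) = expansionOfOne p β (ℓ + q) j := fun q => by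
    induction q generalizing ℓ with
    | zero => simp
    | succ q ih =>
      rw [← add_assoc, hK ℓ (j + q) (by lia), ih]
      congr 1
      push_cast; ring
  simpa using hq p

/-- Weights for which replacing the digit `t_1^(ℓ) + 1` at a position `ℓ` by the string of equal
value that consists of a unit at the preceding position and the digits `t_j^(ℓ+1) - t_{j+1}^(ℓ)` at
the following ones does not increase the total weight. -/
lemma exists_weight [NeZero p] (h : ∀ ℓ : ZMod p, Antitone fun n : ℕ =>
    expansionOfOne p β (ℓ - (n : ZMod p)) n) (K : ℕ) :
    ∃ w : ZMod p → ℝ, (∀ m, 0 < w m) ∧ ∀ ℓ, w (ℓ - 1) + ∑ j ∈ Finset.range K,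
      ((expansionOfOne p β (ℓ + 1) j : ℝ) - expansionOfOne p β ℓ (j + 1)) * w (ℓ + 1 + j) ≤
        (expansionOfOne p β ℓ 0 + 1) * w ℓ := by
  set τ : ZMod p → ℕ → ℝ := fun ℓ j => expansionOfOne p β ℓ j with hτ
  have hd : ∀ (ℓ : ZMod p) (j : ℕ), 0 ≤ τ (ℓ + 1) j - τ ℓ (j + 1) := fun ℓ j =>
    sub_nonneg.2 (Nat.cast_le.2 (expansionOfOne_succ_le h ℓ j))
  set A : Matrix (ZMod p) (ZMod p) ℝ := fun ℓ m => (if m = ℓ - 1 then 1 else 0) +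
    ∑ j ∈ Finset.range K, if m = ℓ + 1 + j then τ (ℓ + 1) j - τ ℓ (j + 1) else 0 with hA
  have hsum0 : ∀ ℓ m : ZMod p, 0 ≤ ∑ j ∈ Finset.range K,
      (if m = ℓ + 1 + j then τ (ℓ + 1) j - τ ℓ (j + 1) else 0) := fun ℓ m =>
    Finset.sum_nonneg fun j _ => by split_ifs <;> simp [hd]
  obtain ⟨w, hw0, hw⟩ := exists_pos_weight A
    (fun ℓ m => add_nonneg (by split_ifs <;> norm_num) (hsum0 ℓ m))
    (fun m => add_pos_of_pos_of_nonneg (by simp) (hsum0 _ _))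
  refine ⟨w, hw0, fun ℓ => ?_⟩
  have hrow : ∑ m, A ℓ m * w m = w (ℓ - 1) + ∑ j ∈ Finset.range K,
      (τ (ℓ + 1) j - τ ℓ (j + 1)) * w (ℓ + 1 + j) := by
    simp only [hA, add_mul, Finset.sum_add_distrib, Finset.sum_mul]
    rw [Finset.sum_comm]
    simp
  -- The column sums telescope along the descending chain through position `ℓ`. The limit of the
  -- chain is what is lost, so the kernel vector yields an inequality, with equality if it is zero.
  have hcol : ∑ k, A k ℓ = 1 + (τ ℓ 0 - τ (ℓ - K) K) := by
    simp only [hA, Finset.sum_add_distrib]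
    rw [Finset.sum_comm]
    congr 1
    · rw [Finset.sum_eq_single (ℓ + 1)]
      · simp
      · intro b _ hb
        exact if_neg fun e => hb (by rw [e]; ring)
      · simp
    · have htel := Finset.sum_range_sub' (fun j : ℕ => τ (ℓ - j) j) K
      simp only [Nat.cast_zero, sub_zero] at htel
      rw [← htel]
      refine Finset.sum_congr rfl fun j _ => ?_
      rw [Finset.sum_eq_single (ℓ - ((j + 1 : ℕ) : ZMod p))]
      · have e1 : ℓ - ((j + 1 : ℕ) : ZMod p) + 1 = ℓ - j := by push_cast; ring
        rw [e1, if_pos (by ring)]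
      · intro b _ hb
        exact if_neg fun e => hb (by rw [e]; push_cast; ring)
      · simp
  rw [← hrow, ← hw ℓ, hcol]
  refine mul_le_mul_of_nonneg_right ?_ (hw0 ℓ).le
  have : 0 ≤ τ (ℓ - K) K := Nat.cast_nonneg _
  simp only [hτ] at this ⊢
  linarith

end One

/-! ### Rewriting by the expansions of one -/

/-- The digitwise effect, for `n ≥ 1`, of replacing the expansion of one starting at position `n`
by a unit at position `n - 1`. -/
noncomputable def carry (β : ℕ → ℝ) (n i : ℕ) : ℤ :=
  (if i + 1 = n then 1 else 0) - (if n ≤ i then (oneDigits β n (i - n) : ℤ) else 0)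

section Carry

variable {β : ℕ → ℝ}

lemma carry_of_lt {n i : ℕ} (h : i + 1 < n) : carry β n i = 0 := by
  simp [carry, h.ne, show ¬ n ≤ i by lia]

lemma carry_pred (n : ℕ) : carry β (n + 1) n = 1 := by
  simp [carry]

lemma carry_add (n j : ℕ) : carry β n (n + j) = -oneDigits β n j := by
  simp [carry, show ¬ n + j + 1 = n by lia]

lemma hasSum_ite_le_sub {c : ℕ → ℝ} {n : ℕ} {s : ℝ} (f : ℕ → ℕ)
    (h : HasSum (fun j => (f j : ℝ) * c (n + j)) s) :
    HasSum (fun i => (((if n ≤ i then (f (i - n) : ℤ) else 0) : ℤ) : ℝ) * c i) s := by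
  rw [← hasSum_nat_add_iff' n, Finset.sum_eq_zero, sub_zero]
  · simpa [add_comm _ n] using h
  · intro i hi
    simp [show ¬ n ≤ i from not_le.2 (Finset.mem_range.1 hi)]

lemma hasSum_carry {c : ℕ → ℝ} {n : ℕ} {s : ℝ}
    (h : HasSum (fun j => (oneDigits β (n + 1) j : ℝ) * c (n + 1 + j)) s) :
    HasSum (fun i => (carry β (n + 1) i : ℝ) * c i) (c n - s) := by
  have key : ∀ i, (carry β (n + 1) i : ℝ) * c i = (if i = n then c n else 0) -
      (((if n + 1 ≤ i then (oneDigits β (n + 1) (i - (n + 1)) : ℤ) else 0) : ℤ) : ℝ) * c i := by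
    intro i
    by_cases hi : i = n
    · simp [carry, hi]
    · simp [carry, hi]
  simp_rw [key]
  exact (hasSum_ite_eq n (c n)).sub (hasSum_ite_le_sub _ h)

/-- A carry does not change the value of a string. -/
lemma hasSum_carry_scale (hβ : IsCantorBase β) (n : ℕ) :
    HasSum (fun i => (carry β (n + 1) i : ℝ) * scale β (i + 1)) 0 := by
  have h := hasSum_carry (c := fun i => scale β (i + 1)) (hasSum_expansion hβ zero_le_one (n + 1))
  simpa using h

/-- Positive weights on the positions, periodic like the base, for which a carry followed by the
reverse of the next carry does not increase the weight. Such a double step changes only finitely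
many digits, because `oneDigits β (n + 1)` agrees with `oneDigits β n` shifted by one from the
position `K` on. -/
structure IsCarryWeight (β : ℕ → ℝ) (p K : ℕ) (w : ℕ → ℝ) : Prop where
  period_pos : 0 < p
  periodic : Function.Periodic w p
  pos : ∀ n, 0 < w n
  digit_le : ∀ n j, oneDigits β n (j + 1) ≤ oneDigits β (n + 1) j
  stable : ∀ n j, K ≤ j → oneDigits β n (j + 1) = oneDigits β (n + 1) j
  carry_le : ∀ n, w n + ∑ j ∈ Finset.range K,
    ((oneDigits β (n + 2) j : ℝ) - oneDigits β (n + 1) (j + 1)) * w (n + 2 + j) ≤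
      (oneDigits β (n + 1) 0 + 1) * w (n + 1)

lemma exists_isCarryWeight {p : ℕ} (hβ : IsAlternateBase p β)
    (h : ∀ ℓ : ZMod p, Antitone fun n : ℕ => expansionOfOne p β (ℓ - (n : ZMod p)) n) :
    ∃ K w, IsCarryWeight β p K w := by
  have : NeZero p := ⟨hβ.2.1.ne'⟩
  obtain ⟨K, hK⟩ := exists_stable h
  obtain ⟨w, hw0, hw⟩ := exists_weight h K
  have hcast : ∀ n : ℕ, oneDigits β n = expansionOfOne p β (n : ZMod p) :=
    fun n => (hβ.expansionOfOne_natCast n).symm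
  refine ⟨K, fun n => w (n : ZMod p), hβ.2.1, fun n => by simp, fun n => hw0 _, fun n j => ?_,
    fun n j hj => ?_, fun n => ?_⟩
  · rw [hcast, hcast, Nat.cast_succ]
    exact expansionOfOne_succ_le h _ j
  · rw [hcast, hcast, Nat.cast_succ]
    exact hK _ j hj
  · have h1 := hw ((n + 1 : ℕ) : ZMod p)
    have e1 : ((n + 1 : ℕ) : ZMod p) - 1 = (n : ZMod p) := by push_cast; ring
    have e2 : ((n + 1 : ℕ) : ZMod p) + 1 = ((n + 2 : ℕ) : ZMod p) := by push_cast; ring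
    rw [e1, e2] at h1
    rw [hcast, hcast]
    simpa only [Nat.cast_add] using h1

variable {p K : ℕ} {w : ℕ → ℝ}

lemma IsCarryWeight.digit_add_le (hw : IsCarryWeight β p K w) (n k j : ℕ) :
    oneDigits β n (k + j) ≤ oneDigits β (n + k) j := by
  induction k generalizing n with
  | zero => simp
  | succ k ih =>
    have h1 := hw.digit_le n (k + j)
    have h2 := ih (n + 1)
    rw [show k + 1 + j = k + j + 1 by ring, show n + (k + 1) = n + 1 + k by ring]
    exact h1.trans h2

lemma IsCarryWeight.exists_le (hw : IsCarryWeight β p K w) : ∃ ε, 0 < ε ∧ ∀ i, ε ≤ w i := by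
  obtain ⟨a, -, ha⟩ := Finset.exists_min_image (Finset.range p) w
    ⟨0, by simpa using hw.period_pos⟩
  refine ⟨w a, hw.pos a, fun i => ?_⟩
  rw [← hw.periodic.map_mod_nat i]
  exact ha _ (Finset.mem_range.2 (Nat.mod_lt _ hw.period_pos))

/-- The difference of consecutive carries does not increase the weight. -/
lemma IsCarryWeight.exists_hasSum_carry_sub_succ (hw : IsCarryWeight β p K w) (n : ℕ) :
    ∃ s ≤ 0, HasSum (fun i => ((carry β (n + 1) i - carry β (n + 2) i : ℤ) : ℝ) * w i) s := by
  have htail : ∀ j, carry β (n + 1) (n + 2 + j) - carry β (n + 2) (n + 2 + j) =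
      oneDigits β (n + 2) j - oneDigits β (n + 1) (j + 1) := fun j => by
    rw [carry_add, show n + 2 + j = n + 1 + (j + 1) by ring, carry_add]
    ring
  refine ⟨_, ?_, hasSum_sum_of_ne_finset_zero (s := Finset.range (n + 2 + K)) fun i hi => ?_⟩
  · rw [Finset.sum_range_add, Finset.sum_range_succ, Finset.sum_range_succ, Finset.sum_eq_zero]
    · simp_rw [htail]
      have h1 : carry β (n + 1) (n + 1) = -oneDigits β (n + 1) 0 := carry_add (n + 1) 0
      have h2 : carry β (n + 2) (n + 1) = 1 := carry_pred (n + 1)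
      have h3 : carry β (n + 2) n = 0 := carry_of_lt (by lia)
      rw [carry_pred, h1, h2, h3]
      have := hw.carry_le n
      push_cast
      linarith
    · intro i hi
      have := Finset.mem_range.1 hi
      rw [carry_of_lt (by lia), carry_of_lt (by lia)]
      simp
  · obtain ⟨j, rfl⟩ := Nat.exists_eq_add_of_le (not_lt.1 (mt Finset.mem_range.2 hi))
    rw [add_assoc, htail, hw.stable (n + 1) (K + j) (by lia)]
    simp

lemma IsCarryWeight.exists_hasSum_carry_sub (hw : IsCarryWeight β p K w) (n k : ℕ) :
    ∃ s ≤ 0, HasSum (fun i => ((carry β (n + 1) i - carry β (n + k + 1) i : ℤ) : ℝ) * w i) s := by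
  induction k with
  | zero => exact ⟨0, le_rfl, by simp⟩
  | succ k ih =>
    obtain ⟨s, hs, h⟩ := ih
    obtain ⟨s', hs', h'⟩ := hw.exists_hasSum_carry_sub_succ (n + k)
    refine ⟨s + s', by linarith, ?_⟩
    convert h.add h' using 2 with i
    rw [← add_assoc, show n + k + 2 = n + k + 1 + 1 by ring]
    push_cast
    ring

/-- If the expansions of one are finite then a full carry does not increase the weight either:
compare with a carry into a position of minimal weight. -/
lemma IsCarryWeight.exists_hasSum_carry (hβ : ∀ n, 1 < β n)
    (hw : IsCarryWeight β p K w) {n : ℕ}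
    (hfin : FiniteSupport (oneDigits β (n + 1))) :
    ∃ s ≤ 0, HasSum (fun i => (carry β (n + 1) i : ℝ) * w i) s := by
  obtain ⟨a, -, ha⟩ := Finset.exists_min_image (Finset.range p) w ⟨0, by simpa using hw.period_pos⟩
  have hmin : ∀ i, w (n * p + a) ≤ w i := fun i => by
    have h1 : w (n * p + a) = w a := by
      rw [add_comm]
      simpa using hw.periodic.nat_mul n a
    rw [h1, ← hw.periodic.map_mod_nat i]
    exact ha _ (Finset.mem_range.2 (Nat.mod_lt _ hw.period_pos))
  obtain ⟨k, hk⟩ := Nat.exists_eq_add_of_le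
    ((Nat.le_mul_of_pos_right n hw.period_pos).trans (Nat.le_add_right (n * p) a))
  rw [hk] at hmin
  have hfin' : FiniteSupport (oneDigits β (n + k + 1)) := by
    clear hmin hk
    induction k with
    | zero => exact hfin
    | succ k ih =>
      refine ((Set.finite_lt_nat K).union (ih.preimage (f := Nat.succ)
        Nat.succ_injective.injOn)).subset fun j hj => ?_
      by_cases hjK : j < K
      · exact Or.inl hjK
      · refine Or.inr ?_
        have := hw.stable (n + k + 1) j (not_lt.1 hjK)
        simp only [Set.mem_preimage, Set.mem_ofPred_eq] at hj ⊢
        rw [Nat.succ_eq_add_one, this]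
        exact hj
  obtain ⟨s, hs, h⟩ := hw.exists_hasSum_carry_sub n k
  have hsm : Summable fun j => (oneDigits β (n + k + 1) j : ℝ) * w (n + k + 1 + j) := by
    refine summable_of_hasFiniteSupport (hfin'.subset fun j hj h0 => hj ?_)
    simp [h0]
  have h' := hasSum_carry (c := w) hsm.hasSum
  have h'' := h.add h'
  simp only [Int.cast_sub, ← add_mul, sub_add_cancel] at h''
  refine ⟨_, ?_, h''⟩
  have h1 := hsm.le_tsum 0 fun j _ => mul_nonneg (Nat.cast_nonneg _) (hw.pos _).le
  have h2 : (1 : ℝ) ≤ oneDigits β (n + k + 1) 0 := by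
    exact_mod_cast one_le_oneDigits_zero hβ _
  have h3 := mul_le_mul_of_nonneg_right h2 (hw.pos (n + k + 1 + 0)).le
  have h4 := hmin (n + k + 1 + 0)
  linarith

end Carry

/-! ### The greedy normal form of a finite string -/

/-- The value of the digits of `b` from position `n` on, measured in the base starting at `n`. -/
noncomputable def tailValue (β : ℕ → ℝ) (b : ℕ → ℕ) (n : ℕ) : ℝ :=
  (∑' j, (b (n + j) : ℝ) * scale β (n + j + 1)) / scale β n

section Tail

variable {β : ℕ → ℝ} {b : ℕ → ℕ}

lemma FiniteSupport.summable (hb : FiniteSupport b) (c : ℕ → ℝ) :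
    Summable fun i => (b i : ℝ) * c i := by
  refine summable_of_hasFiniteSupport (hb.subset fun j hj h0 => hj ?_)
  simp [h0]

lemma FiniteSupport.summable_add (hb : FiniteSupport b) (n : ℕ) :
    Summable fun j => (b (n + j) : ℝ) * scale β (n + j + 1) := by
  simpa [add_comm n] using (summable_nat_add_iff n).2 (hb.summable fun i => scale β (i + 1))

lemma FiniteSupport.exists_eq_zero (hb : FiniteSupport b) : ∃ N, ∀ n, N ≤ n → b n = 0 := by
  obtain ⟨N, hN⟩ := hb.bddAbove
  refine ⟨N + 1, fun n hn => by_contra fun h => ?_⟩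
  have : n ≤ N := hN h
  lia

lemma tailValue_nonneg (hβ : ∀ n, 1 < β n) (n : ℕ) : 0 ≤ tailValue β b n :=
  div_nonneg (tsum_nonneg fun _ => mul_nonneg (Nat.cast_nonneg _) (scale_pos hβ _).le)
    (scale_pos hβ n).le

lemma tailValue_zero : tailValue β b 0 = ∑' i, (b i : ℝ) * scale β (i + 1) := by
  simp [tailValue, scale_zero]

lemma mul_tailValue (hβ : ∀ n, 1 < β n) (hb : FiniteSupport b) (n : ℕ) :
    β n * tailValue β b n = b n + tailValue β b (n + 1) := by
  have h1 := mul_scale_succ hβ n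
  have h2 := (scale_pos hβ (n + 1)).ne'
  have h3 := (zero_lt_one.trans (hβ n)).ne'
  have h4 : (fun j => (b (n + (j + 1)) : ℝ) * scale β (n + (j + 1) + 1)) =
      fun j => (b (n + 1 + j) : ℝ) * scale β (n + 1 + j + 1) := by
    ext j
    rw [add_assoc n 1 j, add_comm 1 j]
  rw [tailValue, tailValue, (hb.summable_add n).tsum_eq_zero_add, h4, ← h1, add_zero]
  field_simp

/-- A finite string all of whose tails have value less than one is greedy. -/
lemma expansion_eq_of_tailValue_lt (hβ : ∀ n, 1 < β n) (hb : FiniteSupport b)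
    (h : ∀ n, tailValue β b n < 1) : expansion β (tailValue β b 0) = b := by
  have hfloor : ∀ n, ⌊β n * tailValue β b n⌋₊ = b n := fun n => by
    rw [mul_tailValue hβ hb, add_comm, Nat.floor_add_natCast (tailValue_nonneg hβ _),
      Nat.floor_eq_zero.2 (h (n + 1)), zero_add]
  have hrem : ∀ n, remainder β (tailValue β b 0) n = tailValue β b n := fun n => by
    induction n with
    | zero => rfl
    | succ n ih => rw [remainder, ih, hfloor, mul_tailValue hβ hb, add_sub_cancel_left]
  ext n
  rw [expansion, hrem, hfloor]

/-- If the last tail of value at least one starts at position `n`, then the digits from there on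
are the expansion of one, or exceed it at the first difference. -/
lemma exceeds_oneDigits (hβ : ∀ n, 1 < β n) (hb : FiniteSupport b) {n : ℕ}
    (hn : 1 ≤ tailValue β b n) (hlt : ∀ m, n < m → tailValue β b m < 1) :
    (∃ k, (∀ j < k, b (n + j) = oneDigits β n j) ∧ oneDigits β n k < b (n + k)) ∨
      ∀ j, b (n + j) = oneDigits β n j := by
  classical
  by_cases hall : ∀ j, b (n + j) = oneDigits β n j
  · exact Or.inr hall
  push Not at hall
  refine Or.inl ⟨Nat.find hall, fun j hj => not_not.1 (Nat.find_min hall hj), ?_⟩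
  have hmin : ∀ j < Nat.find hall, b (n + j) = oneDigits β n j :=
    fun j hj => not_not.1 (Nat.find_min hall hj)
  have hne := Nat.find_spec hall
  set k := Nat.find hall
  have hrec : ∀ j, β (n + j) * remainder (shift β n) 1 j =
      oneDigits β n j + remainder (shift β n) 1 (j + 1) := fun j => by
    rw [add_comm n j]
    exact mul_remainder (β := shift β n) j
  have hge : ∀ j ≤ k, remainder (shift β n) 1 j ≤ tailValue β b (n + j) := fun j => by
    induction j with
    | zero => exact fun _ => hn
    | succ j ih =>
      intro hj
      have h1 := mul_le_mul_of_nonneg_left (ih (by lia)) (zero_lt_one.trans (hβ (n + j))).le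
      rw [hrec, mul_tailValue hβ hb, hmin j (by lia)] at h1
      exact le_of_add_le_add_left h1
  by_contra! hle
  have h1 := mul_le_mul_of_nonneg_left (hge k le_rfl) (zero_lt_one.trans (hβ (n + k))).le
  rw [hrec, mul_tailValue hβ hb] at h1
  have h2 : (b (n + k) : ℝ) + 1 ≤ oneDigits β n k := by
    exact_mod_cast lt_of_le_of_ne hle hne
  have h3 := remainder_nonneg (one_lt_shift hβ n) zero_le_one (k + 1)
  have h4 := hlt (n + k + 1) (by lia)
  linarith

end Tail

section NormalForm

variable {β : ℕ → ℝ} {p K : ℕ} {w : ℕ → ℝ} {M v : ℝ} {b : ℕ → ℕ}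

/-- A digitwise change of value zero and non-positive weight stays inside `boundedRep`, provided
the digits remain non-negative. -/
lemma exists_mem_boundedRep_of_change {c : ℕ → ℝ} (hw : ∀ i, 0 < w i)
    (hfin : FiniteSupport b) (hb : b ∈ boundedRep c w M v) (e : ℕ → ℤ) {s : ℝ} (hs : s ≤ 0)
    (hew : HasSum (fun i => (e i : ℝ) * w i) s) (hec : HasSum (fun i => (e i : ℝ) * c i) 0)
    (hnn : ∀ i, 0 ≤ (b i : ℤ) + e i) :
    ∃ b' ∈ boundedRep c w M v, ∀ i, (b' i : ℤ) = b i + e i := by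
  choose b' hb' using fun i => Int.eq_ofNat_of_zero_le (hnn i)
  have hcast : ∀ i, (b' i : ℝ) = b i + e i := fun i => by exact_mod_cast (hb' i).symm
  have hsum : ∀ (f : ℕ → ℝ) {t : ℝ}, HasSum (fun i => (e i : ℝ) * f i) t →
      HasSum (fun i => (b' i : ℝ) * f i) (∑' i, (b i : ℝ) * f i + t) := fun f t ht => by
    simpa only [hcast, add_mul] using (hfin.summable f).hasSum.add ht
  refine ⟨b', ⟨fun N => ?_, ?_⟩, fun i => (hb' i).symm⟩
  · have h1 := sum_le_hasSum (Finset.range N)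
      (fun i _ => mul_nonneg (Nat.cast_nonneg (b' i)) (hw i).le) (hsum w hew)
    have h2 : ∑' i, (b i : ℝ) * w i ≤ M :=
      Real.tsum_le_of_sum_range_le (fun i => mul_nonneg (Nat.cast_nonneg _) (hw i).le) hb.1
    linarith
  · rw [(hsum c hec).tsum_eq, hb.2, add_zero]

/-- A string with a tail of value at least one can be made lexicographically greater without
changing its value or increasing its weight. -/
lemma IsCarryWeight.exists_lex_greater (hβ : IsCantorBase β) (hw : IsCarryWeight β p K w)
    (hfin : FiniteSupport b) (hb : b ∈ boundedRep (fun i => scale β (i + 1)) w M v) {n : ℕ}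
    (hn : 1 ≤ tailValue β b (n + 1)) (hlt : ∀ m, n + 1 < m → tailValue β b m < 1) :
    ∃ b' ∈ boundedRep (fun i => scale β (i + 1)) w M v,
      (∀ i < n, b' i = b i) ∧ b n < b' n := by
  rcases exceeds_oneDigits hβ.1 hfin hn hlt with ⟨k, hk, hkk⟩ | hall
  · obtain ⟨s, hs, hsw⟩ := hw.exists_hasSum_carry_sub n (k + 1)
    have hval := (hasSum_carry_scale hβ n).sub (hasSum_carry_scale hβ (n + (k + 1)))
    simp only [← sub_mul, ← Int.cast_sub, sub_zero] at hval
    have hlow : ∀ i < n, carry β (n + 1) i - carry β (n + (k + 1) + 1) i = 0 := fun i hi => by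
      rw [carry_of_lt (by lia), carry_of_lt (by lia), sub_zero]
    have hnn1 : carry β (n + 1) n - carry β (n + (k + 1) + 1) n = 1 := by
      rw [carry_pred, carry_of_lt (by lia), sub_zero]
    have hnn : ∀ i, 0 ≤ (b i : ℤ) + (carry β (n + 1) i - carry β (n + (k + 1) + 1) i) := by
      intro i
      rcases lt_trichotomy i n with hi | rfl | hi
      · rw [hlow i hi]; lia
      · rw [hnn1]; lia
      obtain ⟨j, rfl⟩ := Nat.exists_eq_add_of_le (Nat.succ_le_of_lt hi)
      rw [Nat.succ_eq_add_one, carry_add]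
      rcases lt_trichotomy j k with hj | rfl | hj
      · rw [carry_of_lt (by lia), hk j hj]; lia
      · rw [show n + (j + 1) + 1 = n + 1 + j + 1 by ring, carry_pred]; lia
      · obtain ⟨l, rfl⟩ := Nat.exists_eq_add_of_le (Nat.succ_le_of_lt hj)
        rw [Nat.succ_eq_add_one, show n + 1 + (k + 1 + l) = n + (k + 1) + 1 + l by ring, carry_add]
        have h1 := hw.digit_add_le (n + 1) (k + 1) l
        rw [show n + 1 + (k + 1) = n + (k + 1) + 1 by ring] at h1
        lia
    obtain ⟨b', hb', he⟩ := exists_mem_boundedRep_of_change hw.pos hfin hb _ hs hsw hval hnn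
    refine ⟨b', hb', fun i hi => ?_, ?_⟩
    · have := he i
      rw [hlow i hi] at this
      lia
    · have := he n
      rw [hnn1] at this
      lia
  · have hone : FiniteSupport (oneDigits β (n + 1)) := by
      refine (hfin.preimage (f := fun j => n + 1 + j) (add_right_injective _).injOn).subset
        fun j hj => ?_
      simpa [hall j] using hj
    obtain ⟨s, hs, hsw⟩ := hw.exists_hasSum_carry hβ.1 hone
    have hnn : ∀ i, 0 ≤ (b i : ℤ) + carry β (n + 1) i := by
      intro i
      rcases lt_trichotomy i n with hi | rfl | hi
      · rw [carry_of_lt (by lia)]; lia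
      · rw [carry_pred]; lia
      obtain ⟨j, rfl⟩ := Nat.exists_eq_add_of_le (Nat.succ_le_of_lt hi)
      rw [Nat.succ_eq_add_one, carry_add, hall j]
      lia
    obtain ⟨b', hb', he⟩ := exists_mem_boundedRep_of_change hw.pos hfin hb _ hs hsw
      (hasSum_carry_scale hβ n) hnn
    refine ⟨b', hb', fun i hi => ?_, ?_⟩
    · have := he i
      rw [carry_of_lt (by lia)] at this
      lia
    · have := he n
      rw [carry_pred] at this
      lia

/-- A finite string of value less than one is the value of a finite greedy expansion: the
lexicographically greatest string of this value, among those of no larger weight, is greedy. -/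
lemma IsCarryWeight.finiteSupport_expansion (hβ : IsAlternateBase p β)
    (hw : IsCarryWeight β p K w) (hfin : FiniteSupport b)
    (hv : ∑' i, (b i : ℝ) * scale β (i + 1) < 1) :
    FiniteSupport (expansion β (∑' i, (b i : ℝ) * scale β (i + 1))) := by
  obtain ⟨ε, hε, hεw⟩ := hw.exists_le
  set v := ∑' i, (b i : ℝ) * scale β (i + 1) with hvdef
  have hmem : b ∈ boundedRep (fun i => scale β (i + 1)) w (∑' i, (b i : ℝ) * w i) v :=
    ⟨fun N => (hfin.summable w).sum_le_tsum _
      fun i _ => mul_nonneg (Nat.cast_nonneg _) (hw.pos i).le, rfl⟩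
  obtain ⟨a, ha, hmax⟩ := exists_lex_max ((summable_nat_add_iff 1).2 hβ.summable_scale)
    (fun i => (scale_pos hβ.1.1 (i + 1)).le) hε hεw ⟨b, hmem⟩
  have hafin : FiniteSupport a := finiteSupport_of_sum_le hε hεw ha.1
  have hav : tailValue β a 0 = v := tailValue_zero.trans ha.2
  suffices h : ∀ n, tailValue β a n < 1 by
    rw [← hav, expansion_eq_of_tailValue_lt hβ.1.1 hafin h]
    exact hafin
  by_contra! hex
  obtain ⟨N, hN⟩ := hafin.exists_eq_zero
  have hbd : ∀ n, 1 ≤ tailValue β a n → n ≤ N := fun n hn => by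
    by_contra! hlt
    have h0 : tailValue β a n = 0 := by
      simp [tailValue, hN (n + _) (by lia)]
    linarith
  classical
  have hspec := Nat.findGreatest_spec (P := fun n => 1 ≤ tailValue β a n)
    (hbd _ hex.choose_spec) hex.choose_spec
  have hgt : ∀ m, Nat.findGreatest (fun n => 1 ≤ tailValue β a n) N < m →
      tailValue β a m < 1 := fun m hm => by
    by_contra! h1
    exact absurd (Nat.le_findGreatest (hbd m h1) h1) (not_le.2 hm)
  generalize Nat.findGreatest (fun n => 1 ≤ tailValue β a n) N = n at hspec hgt
  cases n with
  | zero =>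
    rw [hav] at hspec
    exact absurd hspec (not_le.2 hv)
  | succ n =>
    obtain ⟨a', ha', hagree, hlt⟩ := hw.exists_lex_greater hβ.1 hafin ha hspec hgt
    exact absurd (hmax a' ha' n hagree) (not_le.2 hlt)

end NormalForm

/-! ### The finiteness properties -/

/-- The values of finite strings of non-negative digits. -/
noncomputable def finiteValues (β : ℕ → ℝ) : AddSubmonoid ℝ :=
  AddSubmonoid.closure (Set.range fun i => scale β (i + 1))

section Finiteness

variable {β : ℕ → ℝ} {p K : ℕ} {w : ℕ → ℝ} {b : ℕ → ℕ} {x y : ℝ}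

lemma scale_mem_finiteValues (i : ℕ) : scale β (i + 1) ∈ finiteValues β :=
  AddSubmonoid.subset_closure ⟨i, rfl⟩

lemma mem_finiteValues_of_hasSum (hb : FiniteSupport b) {n : ℕ}
    (hx : HasSum (fun i => (b i : ℝ) * scale β (n + i + 1)) x) : x ∈ finiteValues β := by
  rw [hx.unique (hasSum_sum_of_ne_finset_zero (s := hb.toFinset) fun i hi => by
    have h0 : b i = 0 := by_contra fun h => hi (hb.mem_toFinset.2 h)
    simp [h0])]
  refine sum_mem fun i _ => ?_
  rw [← nsmul_eq_mul]
  exact nsmul_mem (scale_mem_finiteValues _) _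

lemma exists_hasSum_of_mem_finiteValues (hx : x ∈ finiteValues β) :
    ∃ b : ℕ → ℕ, FiniteSupport b ∧ HasSum (fun i => (b i : ℝ) * scale β (i + 1)) x := by
  induction hx using AddSubmonoid.closure_induction with
  | mem x hx =>
    obtain ⟨i, rfl⟩ := hx
    refine ⟨Pi.single i 1, (Set.finite_singleton i).subset fun j hj => ?_, ?_⟩
    · by_contra hne
      exact hj (Pi.single_eq_of_ne hne 1)
    · convert hasSum_ite_eq i (scale β (i + 1)) using 2 with j
      by_cases hj : j = i
      · subst hj; simp
      · simp [hj]
  | zero => exact ⟨0, by simp [FiniteSupport], by simp⟩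
  | add x y _ _ hx hy =>
    obtain ⟨a, ha, hax⟩ := hx
    obtain ⟨b, hb, hby⟩ := hy
    refine ⟨a + b, (ha.union hb).subset fun j hj => ?_, ?_⟩
    · by_contra h
      simp only [Set.mem_union, Set.mem_ofPred_eq, not_or, not_not] at h
      exact hj (by simp [h.1, h.2])
    · simpa [add_mul] using hax.add hby

lemma nonneg_of_mem_finiteValues (hβ : ∀ n, 1 < β n) (hx : x ∈ finiteValues β) : 0 ≤ x := by
  induction hx using AddSubmonoid.closure_induction with
  | mem x hx => obtain ⟨i, rfl⟩ := hx; exact (scale_pos hβ _).le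
  | zero => exact le_rfl
  | add x y _ _ hx hy => exact add_nonneg hx hy

lemma IsCarryWeight.mem_finSet (hβ : IsAlternateBase p β) (hw : IsCarryWeight β p K w)
    (hx : x ∈ finiteValues β) (hx1 : x < 1) : x ∈ FinSet β := by
  refine ⟨⟨nonneg_of_mem_finiteValues hβ.1.1 hx, hx1⟩, ?_⟩
  obtain ⟨b, hb, hsum⟩ := exists_hasSum_of_mem_finiteValues hx
  have h := hw.finiteSupport_expansion hβ hb (hsum.tsum_eq.trans_lt hx1)
  rwa [hsum.tsum_eq] at h

lemma mem_finiteValues_of_mem_finSet (hβ : IsCantorBase β) (hx : x ∈ FinSet β) :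
    x ∈ finiteValues β := by
  have h := hasSum_expansion hβ hx.1.1 0
  rw [shift_zero, scale_zero, mul_one] at h
  exact mem_finiteValues_of_hasSum hx.2 h

/-- Taking one unit from a position with non-zero digit leaves a finite string. -/
lemma sub_scale_mem_finiteValues (hb : FiniteSupport b) {n j : ℕ} (hj : b j ≠ 0)
    (hx : HasSum (fun i => (b i : ℝ) * scale β (n + i + 1)) x) :
    x - scale β (n + j + 1) ∈ finiteValues β := by
  classical
  refine mem_finiteValues_of_hasSum (b := Function.update b j (b j - 1)) (n := n) ?_ ?_
  · refine (hb.union (Set.finite_singleton j)).subset fun i hi => ?_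
    by_cases hij : i = j
    · exact Or.inr hij
    · refine Or.inl ?_
      simpa [Function.update_of_ne hij] using hi
  · have key : ∀ i, ((Function.update b j (b j - 1) i : ℕ) : ℝ) * scale β (n + i + 1) =
        b i * scale β (n + i + 1) - if i = j then scale β (n + j + 1) else 0 := fun i => by
      by_cases hij : i = j
      · subst hij
        simp [Nat.cast_sub (Nat.one_le_iff_ne_zero.2 hj), sub_mul]
      · simp [hij]
    simp_rw [key]
    exact hx.sub (hasSum_ite_eq j (scale β (n + j + 1)))

/-- If the expansions of one are finite, a unit at one position can be traded for a unit at any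
later position and further non-negative digits. -/
lemma scale_sub_scale_mem_finiteValues (hβ : IsCantorBase β)
    (hone : ∀ n, FiniteSupport (oneDigits β n)) (j k : ℕ) :
    scale β (j + 1) - scale β (j + k + 1) ∈ finiteValues β := by
  induction k with
  | zero => simp
  | succ k ih =>
    have h1 := hasSum_expansion hβ zero_le_one (j + k + 1)
    rw [one_mul] at h1
    have h2 := sub_scale_mem_finiteValues (hone (j + k + 1))
      (Nat.one_le_iff_ne_zero.1 (one_le_oneDigits_zero hβ.1 _)) h1
    simpa [add_assoc] using add_mem ih h2

lemma IsCarryWeight.sub_mem_finSet (hβ : IsAlternateBase p β) (hw : IsCarryWeight β p K w)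
    (hone : ∀ n, FiniteSupport (oneDigits β n)) (hy : y ∈ finiteValues β)
    (hx : x ∈ FinSet β) (hxy : 0 ≤ x - y) : x - y ∈ FinSet β := by
  have hlt : x - y < 1 := by
    linarith [hx.1.2, nonneg_of_mem_finiteValues hβ.1.1 hy]
  induction hy using AddSubmonoid.closure_induction generalizing x with
  | mem y hy =>
    obtain ⟨i, rfl⟩ := hy
    simp only at hxy hlt ⊢
    -- Some digit of `x` at a position up to `i` is non-zero, since otherwise `x < scale β (i + 1)`.
    have hex : ∃ j ≤ i, expansion β x j ≠ 0 := by
      by_contra! h0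
      have h1 := sum_expansion hβ.1.1 x 0 (i + 1)
      rw [Finset.sum_eq_zero fun j hj => by
        rw [shift_zero, h0 j (Nat.lt_succ_iff.1 (Finset.mem_range.1 hj)), Nat.cast_zero, zero_mul],
        shift_zero, scale_zero, zero_add, mul_one] at h1
      have h2 := mul_lt_of_lt_one_left (scale_pos hβ.1.1 (i + 1))
        (remainder_succ_lt_one (β := β) (x := x) i)
      linarith
    obtain ⟨j, hji, hj⟩ := hex
    obtain ⟨k, rfl⟩ := Nat.exists_eq_add_of_le hji
    have h := hasSum_expansion hβ.1 hx.1.1 0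
    rw [shift_zero, scale_zero, mul_one] at h
    have h1 := add_mem (sub_scale_mem_finiteValues hx.2 hj h)
      (scale_sub_scale_mem_finiteValues hβ.1 hone j k)
    rw [zero_add, sub_add_sub_cancel] at h1
    exact hw.mem_finSet hβ h1 hlt
  | zero => simpa using hx
  | add y z hy hz ihy ihz =>
    have hy0 := nonneg_of_mem_finiteValues hβ.1.1 hy
    have hz0 := nonneg_of_mem_finiteValues hβ.1.1 hz
    have h1 := ihy hx (by linarith) (by linarith [hx.1.2])
    rw [← sub_sub] at hxy hlt ⊢
    exact ihz h1 hxy hlt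

end Finiteness

end CantorBase

/-- The hypothesis `h` says, for every `ℓ` modulo `p`, that
`t_1^(ℓ) ≥ t_2^(ℓ-1) ≥ t_3^(ℓ-2) ≥ ⋯`. -/
theorem theorem2 (p : ℕ) (β : ℕ → ℝ) (hβ : CantorBase.IsAlternateBase p β)
    (h : ∀ ℓ : ZMod p, Antitone fun n : ℕ =>
      CantorBase.expansionOfOne p β (ℓ - (n : ZMod p)) n) :
    CantorBase.IsParry p β ∧ CantorBase.PropertyPF β ∧
      (CantorBase.IsSimpleParry p β → CantorBase.PropertyF β) := by
  open CantorBase in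
  have : NeZero p := ⟨hβ.2.1.ne'⟩
  obtain ⟨_, hK⟩ := exists_stable h
  obtain ⟨K, w, hw⟩ := exists_isCarryWeight hβ h
  have hPF : PropertyPF β := fun x hx y hy hxy => hw.mem_finSet hβ
    (add_mem (mem_finiteValues_of_mem_finSet hβ.1 hx) (mem_finiteValues_of_mem_finSet hβ.1 hy))
    hxy.2
  refine ⟨⟨hβ, eventuallyPeriodic_of_stable hK⟩, hPF, fun hs x hx y hy =>
    ⟨hPF x hx y hy, fun hxy => ?_⟩⟩
  refine hw.sub_mem_finSet hβ (fun n => ?_) (mem_finiteValues_of_mem_finSet hβ.1 hy) hx hxy.1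
  rw [← hβ.expansionOfOne_natCast n]
  exact hs.2 n
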